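/- Let $p\in[1,\infty)$, let $\omega$ be a non-principal ultrafilter on $\mathbb N$, and let $(X_i,d_i,e_i)_{i\in\mathbb N}$ be a sequence of pointed complete metric spaces. For a metric space $(X,d)$, let $\mathcal P_p(X)$ be the set of Radon probability measures on $X$ with finite $p$-th moment, with the metric $$W_p(\mu,\nu)=\Bigl(\inf_{\gamma\in\Pi(\mu,\nu)}\int_{X\times X} d(x,y)^p\,d\gamma(x,y)\Bigr)^{1/p},$$ where $\Pi(\mu,\nu)$ is the set of couplings of $\mu$ and $\nu$. For pointed metric spaces $(Y_i,\rho_i,o_i)$, the metric ultralimit $(\hat Y,\hat\rho)$ is the set of sequences $(y_i)\in\prod_i Y_i$ for which $\rho_i(y_i,o_i)$ is bounded $\omega$-almost surely, modulo the relation $\lim_\omega\rho_i(y_i,y_i')=0$, with the distance $\hat\rho(st_{\hat\rho}[(y_i)],st_{\hat\rho}[(y_i')])=\lim_\omega\rho_i(y_i,y_i')$, where $st_{\hat\rho}[(y_i)]$ denotes the class of $(y_i)$. Let $(\hat X,\hat d)$ be the metric ultralimit of $(X_i,d_i,e_i)$, and $(\widehat{\mathcal P_p(X)},\hat W_p)$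 the metric ultralimit of $(\mathcal P_p(X_i),W_p,\delta_{e_i})$. Then there is a canonical isometric embedding $\iota:(\mathcal P_p(\hat X),W_p)\to(\widehat{\mathcal P_p(X)},\hat W_p)$ that extends the map $$\delta_{st_{\hat d}[(x_i)]}\longmapsto st_{\hat W_p}[(\delta_{x_i})].$$ More precisely, there is exactly one isometric embedding $\iota$ that extends this map and satisfies $$\iota\Bigl(\frac1N\sum_{j=1}^N\delta_{st_{\hat d}[(x_{j,i})_i]}\Bigr)=st_{\hat W_p}\Bigl[\Bigl(\frac1N\sum_{j=1}^N\delta_{x_{j,i}}\Bigr)_i\Bigr]$$ for all $N\ge1$ and all sequences $(x_{1,i})_i,\dots,(x_{N,i})_i$ representing points of $\hat X$. -/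

import Mathlib

open MeasureTheory Filter Topology
open scoped ENNReal

universe u

/-! ### Wasserstein spaces of Radon probability measures -/

/-- The set `Π(μ, ν)` of couplings of `μ` and `ν`: the measures on the product whose marginals are
`μ` and `ν`.  (The product carries the product `σ`-algebra.  For Radon `μ` and `ν` every such
coupling is concentrated on a product of `σ`-compact sets, so it makes the distance function
almost everywhere measurable, see `aemeasurable_edist_of_coupling`, and it is the restriction of a
unique Borel measure on the product.) -/
def couplings {X : Type u} [MeasurableSpace X] (μ ν : Measure X) : Set (Measure (X × X)) :=
  {γ | γ.map Prod.fst = μ ∧ γ.map Prod.snd = ν}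

/-- The transport cost `∫ d(x, y) ^ p dγ(x, y)`, with values in `[0, ∞]`. -/
noncomputable def transportCost {X : Type u} [MetricSpace X] [MeasurableSpace X] (p : ℝ)
    (γ : Measure (X × X)) : ℝ≥0∞ :=
  ∫⁻ z, edist z.1 z.2 ^ p ∂γ

/-- `W_p(μ, ν) = (inf_γ ∫ d(x, y) ^ p dγ(x, y)) ^ (1 / p)`, with values in `[0, ∞]`. -/
noncomputable def wassersteinEDist {X : Type u} [MetricSpace X] [MeasurableSpace X] (p : ℝ)
    (μ ν : Measure X) : ℝ≥0∞ :=
  (⨅ γ ∈ couplings μ ν, transportCost p γ) ^ (1 / p)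

/-- The set `𝒫_p(X)` of Radon probability measures on the metric space `X` with finite `p`-th
moment.  Here `Measure.InnerRegular` says that the measure of every Borel set is the supremum of
the measures of its compact subsets. -/
@[ext]
structure WassersteinSpace (p : ℝ) (X : Type u) [MetricSpace X] [MeasurableSpace X]
    [BorelSpace X] where
  /-- the underlying measure -/
  toMeasure : Measure X
  isProb : IsProbabilityMeasure toMeasure
  isRadon : toMeasure.InnerRegular
  finite_moment : ∃ x₀ : X, ∫⁻ x, edist x x₀ ^ p ∂toMeasure < ∞

attribute [instance] WassersteinSpace.isProb WassersteinSpace.isRadon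

set_option linter.unusedSectionVars false

section Aux

variable {X : Type u} [MetricSpace X] [MeasurableSpace X] [BorelSpace X]

theorem exists_sigmaCompact_full (ρ : Measure X) [IsFiniteMeasure ρ] [ρ.InnerRegular] :
    ∃ T : Set X, MeasurableSet T ∧ IsSigmaCompact T ∧ ρ Tᶜ = 0 := by
  have h : ∀ n : ℕ, ∃ K : Set X, IsCompact K ∧ ρ Set.univ < ρ K + ((n : ℝ≥0∞) + 1)⁻¹ := by
    intro n
    obtain ⟨K, -, hK, h⟩ := MeasurableSet.univ.exists_isCompact_lt_add (μ := ρ)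
      (measure_ne_top _ _) (ε := ((n : ℝ≥0∞) + 1)⁻¹) (by simp)
    exact ⟨K, hK, h⟩
  choose K hK hlt using h
  have hm : MeasurableSet (⋃ n, K n) := MeasurableSet.iUnion fun n => (hK n).measurableSet
  refine ⟨⋃ n, K n, hm, isSigmaCompact_iUnion_of_isCompact K hK, ?_⟩
  have hle : ∀ n : ℕ, ρ (⋃ n, K n)ᶜ ≤ ((n : ℝ≥0∞) + 1)⁻¹ := by
    intro n
    have h1 : ρ (⋃ n, K n)ᶜ ≤ ρ (K n)ᶜ :=
      measure_mono (Set.compl_subset_compl.2 (Set.subset_iUnion K n))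
    refine h1.trans ?_
    rw [measure_compl (hK n).measurableSet (measure_ne_top _ _)]
    exact tsub_le_iff_left.2 (hlt n).le
  by_contra hne
  obtain ⟨n, hn⟩ := ENNReal.exists_inv_nat_lt hne
  have h2 : ((n : ℝ≥0∞) + 1)⁻¹ ≤ (n : ℝ≥0∞)⁻¹ := ENNReal.inv_le_inv.2 le_self_add
  exact absurd (lt_of_le_of_lt h2 hn) (not_lt.2 (hle n))

theorem secondCountable_of_isSigmaCompact {T : Set X} (hT : IsSigmaCompact T) :
    SecondCountableTopology T := by
  have : SigmaCompactSpace T := isSigmaCompact_iff_sigmaCompactSpace.1 hT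
  exact EMetric.secondCountable_of_sigmaCompact T


theorem exists_retraction {T : Set X} (hT : MeasurableSet T) (hne : T.Nonempty) :
    ∃ r : X → T, Measurable r ∧ ∀ x ∈ T, (r x : X) = x := by
  obtain ⟨x0, hx0⟩ := hne
  obtain ⟨r, hr, hrT⟩ := (MeasurableEmbedding.subtype_coe hT).exists_measurable_extend
    (measurable_id (α := T)) (fun _ => ⟨⟨x0, hx0⟩⟩)
  refine ⟨r, hr, fun x hx => ?_⟩
  have h := congrFun hrT ⟨x, hx⟩
  simp only [Function.comp_apply, id] at h
  rw [h]

theorem exists_standardBorel_model (ρ : Measure X) [IsProbabilityMeasure ρ] [ρ.InnerRegular] :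
    ∃ (Z : Type u) (_ : MeasurableSpace Z) (_ : StandardBorelSpace Z) (f : X → Z) (g : Z → X),
      Measurable f ∧ Measurable g ∧ ∀ᵐ x ∂ρ, g (f x) = x := by
  obtain ⟨T, hTm, hT, hT0⟩ := exists_sigmaCompact_full ρ
  have hne : T.Nonempty := by
    rw [Set.nonempty_iff_ne_empty]
    rintro rfl
    simp at hT0
  have : SigmaCompactSpace T := isSigmaCompact_iff_sigmaCompactSpace.1 hT
  have : SecondCountableTopology T := EMetric.secondCountable_of_sigmaCompact T
  let c : T → UniformSpace.Completion T := fun x => (x : UniformSpace.Completion T)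
  have : SecondCountableTopology (UniformSpace.Completion T) :=
    UniformSpace.secondCountable_of_separable _
  borelize (UniformSpace.Completion T)
  have hc : IsEmbedding c := (UniformSpace.Completion.isUniformEmbedding_coe T).isEmbedding
  have hr : MeasurableSet (Set.range c) := by
    obtain ⟨K, hK, hU⟩ := isSigmaCompact_range hc.continuous
    rw [← hU]
    exact MeasurableSet.iUnion fun n => (hK n).measurableSet
  obtain ⟨r, hrm, hrT⟩ := exists_retraction hTm hne
  let E : T ≃ₜ Set.range c := hc.toHomeomorph
  refine ⟨Set.range c, inferInstance, hr.standardBorel, fun x => E (r x),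
    fun z => (E.symm z : X), E.continuous.measurable.comp hrm,
    measurable_subtype_coe.comp E.symm.continuous.measurable, ?_⟩
  have hae : ∀ᵐ x ∂ρ, x ∈ T := hT0
  filter_upwards [hae] with x hx
  rw [E.symm_apply_apply, hrT x hx]

/-- The distance function is almost everywhere measurable for every coupling of Radon measures. -/
theorem aemeasurable_edist_of_coupling {μ ν : Measure X} [IsProbabilityMeasure μ] [μ.InnerRegular]
    [IsProbabilityMeasure ν] [ν.InnerRegular] {γ : Measure (X × X)} (hγ : γ ∈ couplings μ ν) :
    AEMeasurable (fun z : X × X => edist z.1 z.2) γ := by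
  obtain ⟨T, hTm, hT, hT0⟩ := exists_sigmaCompact_full (μ + ν)
  have hT0' : μ Tᶜ = 0 ∧ ν Tᶜ = 0 := by simpa using hT0
  have hne : T.Nonempty := by
    rw [Set.nonempty_iff_ne_empty]
    rintro rfl
    simp at hT0'
  have := secondCountable_of_isSigmaCompact hT
  obtain ⟨r, hrm, hrT⟩ := exists_retraction hTm hne
  refine ⟨fun z => edist (r z.1) (r z.2),
    (hrm.comp measurable_fst).edist (hrm.comp measurable_snd), ?_⟩
  have h1 : ∀ᵐ z ∂γ, z.1 ∈ T := by
    have h : ∀ᵐ x ∂(γ.map Prod.fst), x ∈ T := by rw [hγ.1]; exact hT0'.1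
    exact ae_of_ae_map measurable_fst.aemeasurable h
  have h2 : ∀ᵐ z ∂γ, z.2 ∈ T := by
    have h : ∀ᵐ x ∂(γ.map Prod.snd), x ∈ T := by rw [hγ.2]; exact hT0'.2
    exact ae_of_ae_map measurable_snd.aemeasurable h
  filter_upwards [h1, h2] with z hz1 hz2
  rw [Subtype.edist_eq, hrT _ hz1, hrT _ hz2]

theorem isProbabilityMeasure_of_coupling {μ ν : Measure X} [IsProbabilityMeasure μ]
    {γ : Measure (X × X)} (hγ : γ ∈ couplings μ ν) : IsProbabilityMeasure γ := by
  constructor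
  have h : γ.map Prod.fst Set.univ = μ Set.univ := by rw [hγ.1]
  rw [Measure.map_apply measurable_fst MeasurableSet.univ, Set.preimage_univ] at h
  rw [h, measure_univ]

/-- Gluing of couplings along a common marginal. -/
theorem exists_gluing {μ ν ρ : Measure X} [IsProbabilityMeasure μ]
    [IsProbabilityMeasure ν] [IsProbabilityMeasure ρ] [ρ.InnerRegular] {γ γ' : Measure (X × X)}
    (hγ : γ ∈ couplings μ ν) (hγ' : γ' ∈ couplings ν ρ) :
    ∃ π : Measure ((X × X) × X), π.map Prod.fst = γ ∧ π.map (fun t => (t.1.2, t.2)) = γ' := by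
  have := isProbabilityMeasure_of_coupling hγ
  have := isProbabilityMeasure_of_coupling hγ'
  obtain ⟨Z, _, _, f, g, hf, hg, hgf⟩ := exists_standardBorel_model ρ
  have hF : Measurable (Prod.map id f : X × X → X × Z) := measurable_id.prodMap hf
  have hG : Measurable (Prod.map id g : X × Z → X × X) := measurable_id.prodMap hg
  have : Nonempty X := by
    by_contra h
    rw [not_nonempty_iff] at h
    exact IsProbabilityMeasure.ne_zero μ (Measure.eq_zero_of_isEmpty μ)
  have : Nonempty Z := ‹Nonempty X›.map f
  let σ : Measure (X × Z) := γ'.map (Prod.map id f)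
  have hσp : IsProbabilityMeasure σ := Measure.isProbabilityMeasure_map hF.aemeasurable
  have hσ : σ.map (Prod.map id g) = γ' := by
    rw [Measure.map_map hG hF]
    have h : ∀ᵐ z ∂γ', g (f z.2) = z.2 := by
      refine ae_of_ae_map (p := fun x => g (f x) = x) measurable_snd.aemeasurable ?_
      rw [hγ'.2]
      exact hgf
    conv_rhs => rw [← Measure.map_id (μ := γ')]
    refine Measure.map_congr ?_
    filter_upwards [h] with z hz
    exact Prod.ext rfl hz
  have hσ1 : σ.fst = ν := by
    rw [Measure.fst, Measure.map_map measurable_fst hF, ← hγ'.1]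
    rfl
  let κ : ProbabilityTheory.Kernel (X × X) Z := σ.condKernel.comap Prod.snd measurable_snd
  let π₀ : Measure ((X × X) × Z) := γ.compProd κ
  have hπ1 : π₀.map Prod.fst = γ := Measure.fst_compProd γ κ
  have hm : Measurable (fun t : (X × X) × Z => (t.1.2, t.2)) := by fun_prop
  have hπ2 : π₀.map (fun t => (t.1.2, t.2)) = σ := by
    conv_rhs => rw [← σ.disintegrate σ.condKernel, hσ1]
    ext s hs
    rw [Measure.map_apply hm hs, Measure.compProd_apply (hm hs), Measure.compProd_apply hs,
      ← hγ.2, lintegral_map (ProbabilityTheory.Kernel.measurable_kernel_prodMk_left hs)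
        measurable_snd]
    rfl
  have hH : Measurable (Prod.map id g : (X × X) × Z → (X × X) × X) := measurable_id.prodMap hg
  refine ⟨π₀.map (Prod.map id g), ?_, ?_⟩
  · rw [Measure.map_map measurable_fst hH, ← hπ1]
    rfl
  · rw [Measure.map_map (by fun_prop) hH, ← hσ, ← hπ2, Measure.map_map hG hm]
    rfl

theorem wassersteinEDist_self (p : ℝ) (hp : 1 ≤ p) (μ : Measure X) : wassersteinEDist p μ μ = 0 := by
  have h : transportCost p (μ.map fun x => (x, x)) ≤ 0 := by
    refine (lintegral_map_le _ _).trans ?_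
    simp [ENNReal.zero_rpow_of_pos (by linarith : 0 < p)]
  have hc : μ.map (fun x => (x, x)) ∈ couplings μ μ := by
    have hm : Measurable (fun x : X => (x, x)) := by fun_prop
    constructor
    · rw [Measure.map_map measurable_fst hm]; exact Measure.map_id
    · rw [Measure.map_map measurable_snd hm]; exact Measure.map_id
  have h0 : (⨅ γ ∈ couplings μ μ, transportCost p γ) = 0 :=
    le_antisymm ((iInf₂_le _ hc).trans h) bot_le
  rw [wassersteinEDist, h0, ENNReal.zero_rpow_of_pos (by positivity)]

theorem wassersteinEDist_comm (p : ℝ) (μ ν : Measure X) :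
    wassersteinEDist p μ ν = wassersteinEDist p ν μ := by
  have key : ∀ μ ν : Measure X, (⨅ γ ∈ couplings μ ν, transportCost p γ) ≤
      ⨅ γ ∈ couplings ν μ, transportCost p γ := by
    intro μ ν
    refine le_iInf₂ fun γ hγ => ?_
    have hs : γ.map Prod.swap ∈ couplings μ ν := by
      constructor
      · rw [Measure.map_map measurable_fst measurable_swap, ← hγ.2]; rfl
      · rw [Measure.map_map measurable_snd measurable_swap, ← hγ.1]; rfl
    refine (iInf₂_le _ hs).trans ((lintegral_map_le _ _).trans (le_of_eq ?_))
    simp [transportCost, edist_comm]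
  rw [wassersteinEDist, wassersteinEDist, le_antisymm (key μ ν) (key ν μ)]

theorem wassersteinEDist_triangle (p : ℝ) (hp : 1 ≤ p) (μ ν ρ : Measure X)
    [IsProbabilityMeasure μ] [IsProbabilityMeasure ν] [IsProbabilityMeasure ρ]
    [μ.InnerRegular] [ν.InnerRegular] [ρ.InnerRegular] :
    wassersteinEDist p μ ρ ≤ wassersteinEDist p μ ν + wassersteinEDist p ν ρ := by
  have hp0 : 0 < p := by linarith
  have hq : 0 < 1 / p := by positivity
  have hmono : ∀ {a b : ℝ≥0∞}, a ≤ b → a ^ (1 / p) ≤ b ^ (1 / p) :=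
    fun h => ENNReal.rpow_le_rpow h hq.le
  have key : ∀ γ ∈ couplings μ ν, ∀ γ' ∈ couplings ν ρ, wassersteinEDist p μ ρ ≤
      transportCost p γ ^ (1 / p) + transportCost p γ' ^ (1 / p) := by
    intro γ hγ γ' hγ'
    obtain ⟨π, h1, h2⟩ := exists_gluing hγ hγ'
    have m1 : Measurable (fun t : (X × X) × X => t.1) := by fun_prop
    have m2 : Measurable (fun t : (X × X) × X => (t.1.2, t.2)) := by fun_prop
    have m3 : Measurable (fun t : (X × X) × X => (t.1.1, t.2)) := by fun_prop
    have a1 : AEMeasurable (fun z : X × X => edist z.1 z.2) (π.map fun t => t.1) := by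
      have h := aemeasurable_edist_of_coupling hγ
      rwa [← h1] at h
    have a2 : AEMeasurable (fun z : X × X => edist z.1 z.2) (π.map fun t => (t.1.2, t.2)) := by
      rw [h2]; exact aemeasurable_edist_of_coupling hγ'
    have hc : π.map (fun t => (t.1.1, t.2)) ∈ couplings μ ρ := by
      constructor
      · rw [Measure.map_map measurable_fst m3, ← hγ.1, ← h1,
          Measure.map_map measurable_fst measurable_fst]
        rfl
      · rw [Measure.map_map measurable_snd m3, ← hγ'.2, ← h2,
          Measure.map_map measurable_snd m2]
        rfl
    have c1 : ∫⁻ t, edist t.1.1 t.1.2 ^ p ∂π = transportCost p γ := by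
      rw [transportCost, ← h1]
      exact (lintegral_map' (a1.pow_const p) m1.aemeasurable).symm
    have c2 : ∫⁻ t, edist t.1.2 t.2 ^ p ∂π = transportCost p γ' := by
      rw [transportCost, ← h2]
      exact (lintegral_map' (a2.pow_const p) m2.aemeasurable).symm
    calc wassersteinEDist p μ ρ
        ≤ transportCost p (π.map fun t => (t.1.1, t.2)) ^ (1 / p) := hmono (iInf₂_le _ hc)
      _ ≤ (∫⁻ t, edist t.1.1 t.2 ^ p ∂π) ^ (1 / p) := hmono (lintegral_map_le _ _)
      _ ≤ (∫⁻ t, ((fun t : (X × X) × X => edist t.1.1 t.1.2) +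
            fun t : (X × X) × X => edist t.1.2 t.2) t ^ p ∂π) ^ (1 / p) := by
          refine hmono (lintegral_mono fun t => ENNReal.rpow_le_rpow ?_ hp0.le)
          exact edist_triangle _ _ _
      _ ≤ (∫⁻ t, edist t.1.1 t.1.2 ^ p ∂π) ^ (1 / p) +
            (∫⁻ t, edist t.1.2 t.2 ^ p ∂π) ^ (1 / p) :=
          ENNReal.lintegral_Lp_add_le (a1.comp_measurable m1) (a2.comp_measurable m2) hp
      _ = transportCost p γ ^ (1 / p) + transportCost p γ' ^ (1 / p) := by rw [c1, c2]
  have hinf : ∀ α β : Measure X, wassersteinEDist p α β =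
      ⨅ γ ∈ couplings α β, transportCost p γ ^ (1 / p) := by
    intro α β
    exact (ENNReal.orderIsoRpow (1 / p) hq).map_iInf₂
      (fun (γ : Measure (X × X)) (_ : γ ∈ couplings α β) => transportCost p γ)
  rw [hinf μ ν, hinf ν ρ]
  exact ENNReal.le_iInf₂_add_iInf₂ fun γ hγ γ' hγ' => key γ hγ γ' hγ'

instance innerRegular_dirac (a : X) : (Measure.dirac a).InnerRegular := by
  constructor
  intro U hU r hr
  rw [Measure.dirac_apply' _ hU] at hr
  by_cases ha : a ∈ U
  · refine ⟨{a}, Set.singleton_subset_iff.2 ha, isCompact_singleton, ?_⟩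
    simpa [ha] using hr
  · simp [ha] at hr

theorem wassersteinEDist_dirac_le (p : ℝ) (hp : 1 ≤ p) (μ : Measure X) [IsProbabilityMeasure μ]
    (a : X) :
    wassersteinEDist p μ (Measure.dirac a) ≤ (∫⁻ x, edist x a ^ p ∂μ) ^ (1 / p) := by
  have hm : Measurable (fun x : X => (x, a)) := by fun_prop
  have hc : μ.map (fun x => (x, a)) ∈ couplings μ (Measure.dirac a) := by
    constructor
    · rw [Measure.map_map measurable_fst hm]; exact Measure.map_id
    · rw [Measure.map_map measurable_snd hm]
      have h : (Prod.snd ∘ fun x : X => (x, a)) = fun _ => a := rfl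
      rw [h, Measure.map_const, measure_univ, one_smul]
  exact ENNReal.rpow_le_rpow ((iInf₂_le _ hc).trans (lintegral_map_le _ _)) (by positivity)

theorem wassersteinEDist_ne_top (p : ℝ) (hp : 1 ≤ p) (μ ν : WassersteinSpace p X) :
    wassersteinEDist p μ.toMeasure ν.toMeasure ≠ ∞ := by
  have hq : 0 ≤ 1 / p := by positivity
  obtain ⟨a, ha⟩ := μ.finite_moment
  obtain ⟨b, hb⟩ := ν.finite_moment
  have h1 : wassersteinEDist p μ.toMeasure (Measure.dirac a) ≠ ∞ :=
    ((wassersteinEDist_dirac_le p hp _ a).trans_lt (ENNReal.rpow_lt_top_of_nonneg hq ha.ne)).ne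
  have h2 : wassersteinEDist p (Measure.dirac b) ν.toMeasure ≠ ∞ := by
    rw [wassersteinEDist_comm]
    exact ((wassersteinEDist_dirac_le p hp _ b).trans_lt
      (ENNReal.rpow_lt_top_of_nonneg hq hb.ne)).ne
  have h3 : wassersteinEDist p (Measure.dirac a) (Measure.dirac b) ≠ ∞ := by
    refine ((wassersteinEDist_dirac_le p hp _ b).trans_lt
      (ENNReal.rpow_lt_top_of_nonneg hq ?_)).ne
    rw [lintegral_dirac]
    exact ENNReal.rpow_ne_top_of_nonneg (by linarith) (edist_ne_top a b)
  refine ((wassersteinEDist_triangle p hp _ (Measure.dirac a) _).trans_lt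
    (ENNReal.add_lt_top.2 ⟨h1.lt_top, ?_⟩)).ne
  exact (wassersteinEDist_triangle p hp _ (Measure.dirac b) _).trans_lt
    (ENNReal.add_lt_top.2 ⟨h3.lt_top, h2.lt_top⟩)

theorem measure_le_of_wassersteinEDist_eq_zero (p : ℝ) (hp : 1 ≤ p) (μ ν : Measure X)
    [IsProbabilityMeasure μ] [IsProbabilityMeasure ν] [μ.InnerRegular] [ν.InnerRegular]
    (h : wassersteinEDist p μ ν = 0) {F : Set X} (hF : IsClosed F) : μ F ≤ ν F := by
  have hp0 : 0 < p := by linarith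
  have hq : 0 < 1 / p := by positivity
  have hinf : (⨅ γ ∈ couplings μ ν, transportCost p γ) = 0 := by
    rcases ENNReal.rpow_eq_zero_iff.1 h with h' | h'
    · exact h'.1
    · exact absurd h'.2 (not_lt.2 hq.le)
  have key : ∀ δ : ℝ, 0 < δ → μ F ≤ ν (Metric.cthickening δ F) := by
    intro δ hδ
    refine ENNReal.le_of_forall_pos_le_add fun ε hε _ => ?_
    have hd0 : ENNReal.ofReal δ ^ p ≠ 0 := by
      simp [ENNReal.rpow_eq_zero_iff, hδ]
    have hdt : ENNReal.ofReal δ ^ p ≠ ∞ := by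
      simp [ENNReal.rpow_eq_top_iff, hp0.le]
    have hlt : (⨅ γ ∈ couplings μ ν, transportCost p γ) < ENNReal.ofReal δ ^ p * ε := by
      rw [hinf]
      exact ENNReal.mul_pos hd0 (by simpa using hε.ne')
    obtain ⟨γ, hγ⟩ := iInf_lt_iff.1 hlt
    obtain ⟨hγc, hγl⟩ := iInf_lt_iff.1 hγ
    have hae := (aemeasurable_edist_of_coupling hγc).pow_const p
    have hcheb := mul_meas_ge_le_lintegral₀ hae (ENNReal.ofReal δ ^ p)
    have hbad : γ {z | ENNReal.ofReal δ ^ p ≤ edist z.1 z.2 ^ p} ≤ ε := by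
      have h1 := hcheb.trans hγl.le
      exact (ENNReal.mul_le_mul_iff_right hd0 hdt).1 h1
    calc μ F = γ (Prod.fst ⁻¹' F) := by
          rw [← hγc.1, Measure.map_apply measurable_fst hF.measurableSet]
      _ ≤ γ (Prod.snd ⁻¹' (Metric.cthickening δ F) ∪
            {z | ENNReal.ofReal δ ^ p ≤ edist z.1 z.2 ^ p}) := by
          refine measure_mono fun z hz => ?_
          by_cases hzd : edist z.1 z.2 ≤ ENNReal.ofReal δ
          · left
            refine Metric.mem_cthickening_of_edist_le z.2 z.1 δ F hz ?_
            rwa [edist_comm]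
          · right
            exact ENNReal.rpow_le_rpow (not_le.1 hzd).le hp0.le
      _ ≤ γ (Prod.snd ⁻¹' (Metric.cthickening δ F)) +
            γ {z | ENNReal.ofReal δ ^ p ≤ edist z.1 z.2 ^ p} := measure_union_le _ _
      _ ≤ ν (Metric.cthickening δ F) + ε := by
          refine add_le_add (le_of_eq ?_) hbad
          rw [← hγc.2, Measure.map_apply measurable_snd Metric.isClosed_cthickening.measurableSet]
  have ht : Tendsto (fun r => ν (Metric.cthickening r F)) (𝓝[>] 0) (𝓝 (ν F)) :=
    (tendsto_measure_cthickening_of_isClosed ⟨1, one_pos, measure_ne_top _ _⟩ hF).mono_left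
      nhdsWithin_le_nhds
  exact ge_of_tendsto ht (eventually_nhdsWithin_of_forall fun δ hδ => key δ hδ)

theorem eq_of_wassersteinEDist_eq_zero (p : ℝ) (hp : 1 ≤ p) (μ ν : Measure X)
    [IsProbabilityMeasure μ] [IsProbabilityMeasure ν] [μ.InnerRegular] [ν.InnerRegular]
    (h : wassersteinEDist p μ ν = 0) : μ = ν := by
  refine ext_of_generate_finite {s : Set X | IsClosed s} ?_ isPiSystem_isClosed ?_ ?_
  · rw [BorelSpace.measurable_eq (α := X), borel_eq_generateFrom_isClosed]
  · intro F hF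
    refine le_antisymm (measure_le_of_wassersteinEDist_eq_zero p hp μ ν h hF) ?_
    rw [wassersteinEDist_comm] at h
    exact measure_le_of_wassersteinEDist_eq_zero p hp ν μ h hF
  · rw [measure_univ, measure_univ]

end Aux

/-- `(𝒫_p(X), W_p)` as a metric space. -/
noncomputable instance WassersteinSpace.instMetricSpace {p : ℝ} [hp : Fact (1 ≤ p)] {X : Type u}
    [MetricSpace X] [MeasurableSpace X] [BorelSpace X] : MetricSpace (WassersteinSpace p X) where
  dist μ ν := (wassersteinEDist p μ.toMeasure ν.toMeasure).toReal
  dist_self μ := by simp [wassersteinEDist_self p hp.out]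
  dist_comm μ ν := by rw [wassersteinEDist_comm]
  dist_triangle μ ν ρ := by
    rw [← ENNReal.toReal_add (wassersteinEDist_ne_top p hp.out _ _)
      (wassersteinEDist_ne_top p hp.out _ _)]
    exact ENNReal.toReal_mono (ENNReal.add_ne_top.2 ⟨wassersteinEDist_ne_top p hp.out _ _,
      wassersteinEDist_ne_top p hp.out _ _⟩) (wassersteinEDist_triangle p hp.out _ _ _)
  eq_of_dist_eq_zero {μ ν} h := by
    rcases (ENNReal.toReal_eq_zero_iff _).1 h with h0 | h0
    · exact WassersteinSpace.ext (eq_of_wassersteinEDist_eq_zero p hp.out _ _ h0)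
    · exact absurd h0 (wassersteinEDist_ne_top p hp.out _ _)

namespace WassersteinSpace

variable {X : Type u} [MetricSpace X] [MeasurableSpace X] [BorelSpace X]

/-- The uniform Dirac cloud `(1 / N) ∑ⱼ δ_{xⱼ}`, for `N ≥ 1`. -/
noncomputable def cloud (p : ℝ) [hp : Fact (1 ≤ p)] {N : ℕ} [NeZero N] (x : Fin N → X) :
    WassersteinSpace p X where
  toMeasure := (N : ℝ≥0∞)⁻¹ • ∑ j, Measure.dirac (x j)
  isProb := ⟨by
    simp [ENNReal.inv_mul_cancel (Nat.cast_ne_zero.2 (NeZero.ne N)) (ENNReal.natCast_ne_top N)]⟩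
  isRadon := inferInstance
  finite_moment := by
    refine ⟨x 0, ?_⟩
    rw [lintegral_smul_measure, lintegral_finsetSum_measure]
    refine ENNReal.mul_lt_top (by simp [NeZero.pos N]) (ENNReal.sum_lt_top.2 fun j _ => ?_)
    rw [lintegral_dirac]
    exact ENNReal.rpow_lt_top_of_nonneg (by linarith [hp.out]) (edist_ne_top _ _)

/-- The Dirac mass `δ_a`. -/
noncomputable def dirac (p : ℝ) [hp : Fact (1 ≤ p)] (a : X) : WassersteinSpace p X where
  toMeasure := Measure.dirac a
  isProb := inferInstance
  isRadon := inferInstance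
  finite_moment := by
    refine ⟨a, ?_⟩
    rw [lintegral_dirac, edist_self, ENNReal.zero_rpow_of_pos (by linarith [hp.out])]
    exact ENNReal.zero_lt_top

theorem dist_cloud_dirac_le (p : ℝ) [hp : Fact (1 ≤ p)] {N : ℕ} [NeZero N] (x : Fin N → X) (a : X)
    {C : ℝ} (hC : ∀ j, dist (x j) a ≤ C) : dist (cloud p x) (dirac p a) ≤ C := by
  have hp0 : 0 < p := by linarith [hp.out]
  have hC0 : 0 ≤ C := dist_nonneg.trans (hC 0)
  refine ENNReal.toReal_le_of_le_ofReal hC0 ?_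
  refine (wassersteinEDist_dirac_le p hp.out (cloud p x).toMeasure a).trans ?_
  have h : ∫⁻ y, edist y a ^ p ∂(cloud p x).toMeasure ≤ ENNReal.ofReal C ^ p := by
    simp only [cloud]
    rw [lintegral_smul_measure, lintegral_finsetSum_measure]
    simp only [lintegral_dirac, smul_eq_mul]
    calc (N : ℝ≥0∞)⁻¹ * ∑ j, edist (x j) a ^ p
        ≤ (N : ℝ≥0∞)⁻¹ * ∑ _j : Fin N, ENNReal.ofReal C ^ p := by
          gcongr with j
          rw [edist_dist]
          exact ENNReal.ofReal_le_ofReal (hC j)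
      _ = ENNReal.ofReal C ^ p := by
          rw [Finset.sum_const, Finset.card_univ, Fintype.card_fin, nsmul_eq_mul, ← mul_assoc,
            ENNReal.inv_mul_cancel (Nat.cast_ne_zero.2 (NeZero.ne N)) (ENNReal.natCast_ne_top N),
            one_mul]
  refine (ENNReal.rpow_le_rpow h (by positivity)).trans (le_of_eq ?_)
  rw [← ENNReal.rpow_mul, mul_one_div_cancel hp0.ne', ENNReal.rpow_one]

theorem dist_dirac_dirac_le (p : ℝ) [hp : Fact (1 ≤ p)] (x a : X) :
    dist (dirac p x) (dirac p a) ≤ dist x a := by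
  have h : dirac p x = cloud p (fun _ : Fin 1 => x) := by
    apply WassersteinSpace.ext
    simp [dirac, cloud]
  rw [h]
  exact dist_cloud_dirac_le p _ a fun _ => le_rfl

end WassersteinSpace

/-! ### Metric ultralimits of pointed metric spaces -/

/-- The limited sequences: those `(x_i)` for which `d_i(x_i, e_i)` is bounded `ω`-almost surely,
i.e. for which `[d_i(x_i, e_i)]` is a finite hyperreal. -/
def LimitedSeq (ω : Ultrafilter ℕ) (X : ℕ → Type u) [∀ i, MetricSpace (X i)] (e : ∀ i, X i) :
    Type u :=
  {x : ∀ i, X i // ∃ C : ℝ, ∀ᶠ i in (ω : Filter ℕ), dist (x i) (e i) ≤ C}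

/-- A real sequence that is bounded `ω`-almost surely converges along the ultrafilter `ω`. -/
theorem tendsto_limUnder_ultrafilter (ω : Ultrafilter ℕ) {f : ℕ → ℝ} {C : ℝ}
    (h : ∀ᶠ i in (ω : Filter ℕ), f i ∈ Set.Icc 0 C) :
    Tendsto f ω (𝓝 (limUnder (ω : Filter ℕ) f)) := by
  obtain ⟨x, -, hx⟩ := (isCompact_Icc (a := (0 : ℝ)) (b := C)).ultrafilter_le_nhds' (ω.map f) h
  exact tendsto_nhds_limUnder ⟨x, hx⟩

namespace LimitedSeq

variable {ω : Ultrafilter ℕ} {X : ℕ → Type u} [∀ i, MetricSpace (X i)] {e : ∀ i, X i}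

theorem tendsto_dist (x y : LimitedSeq ω X e) :
    Tendsto (fun i => dist (x.1 i) (y.1 i)) ω
      (𝓝 (limUnder (ω : Filter ℕ) fun i => dist (x.1 i) (y.1 i))) := by
  obtain ⟨C, hC⟩ := x.2
  obtain ⟨D, hD⟩ := y.2
  refine tendsto_limUnder_ultrafilter ω (C := C + D) ?_
  filter_upwards [hC, hD] with i h1 h2
  refine ⟨dist_nonneg, (dist_triangle_right _ _ (e i)).trans (add_le_add h1 h2)⟩

/-- The pseudodistance `lim_ω d_i(x_i, y_i)`, which is the standard part of `[d_i(x_i, y_i)]`. -/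
noncomputable instance : PseudoMetricSpace (LimitedSeq ω X e) where
  dist x y := limUnder (ω : Filter ℕ) fun i => dist (x.1 i) (y.1 i)
  dist_self x := tendsto_nhds_unique (tendsto_dist x x) (by simp)
  dist_comm x y := by simp only [dist_comm]
  dist_triangle x y z :=
    le_of_tendsto_of_tendsto' (tendsto_dist x z) ((tendsto_dist x y).add (tendsto_dist y z))
      fun _ => dist_triangle _ _ _

end LimitedSeq

/-- The metric ultralimit of the pointed metric spaces `(X_i, d_i, e_i)` along `ω`: the limited
sequences modulo the relation `lim_ω d_i(x_i, y_i) = 0`, with the distance `lim_ω d_i(x_i, y_i)`.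
(Sequences that agree `ω`-almost surely are in particular identified.) -/
def MetricUltralimit (ω : Ultrafilter ℕ) (X : ℕ → Type u) [∀ i, MetricSpace (X i)]
    (e : ∀ i, X i) : Type u :=
  SeparationQuotient (LimitedSeq ω X e)

namespace MetricUltralimit

variable {ω : Ultrafilter ℕ} {X : ℕ → Type u} [∀ i, MetricSpace (X i)] {e : ∀ i, X i}

noncomputable instance : MetricSpace (MetricUltralimit ω X e) :=
  inferInstanceAs (MetricSpace (SeparationQuotient (LimitedSeq ω X e)))

noncomputable instance : MeasurableSpace (MetricUltralimit ω X e) := borel _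

instance : BorelSpace (MetricUltralimit ω X e) := ⟨rfl⟩

/-- The point `st[(x_i)]` of the metric ultralimit given by a limited sequence `(x_i)`. -/
noncomputable def st (x : LimitedSeq ω X e) : MetricUltralimit ω X e :=
  SeparationQuotient.mk x

end MetricUltralimit

namespace LimitedSeq

variable {ω : Ultrafilter ℕ} {X : ℕ → Type u} [∀ i, MetricSpace (X i)]
  [∀ i, MeasurableSpace (X i)] [∀ i, BorelSpace (X i)] {e : ∀ i, X i}

/-- The sequence `(δ_{x_i})` of Dirac masses, which is limited in `(𝒫_p(X_i), W_p, δ_{e_i})`. -/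
noncomputable def dirac (p : ℝ) [Fact (1 ≤ p)] (x : LimitedSeq ω X e) :
    LimitedSeq ω (fun i => WassersteinSpace p (X i)) (fun i => WassersteinSpace.dirac p (e i)) :=
  ⟨fun i => WassersteinSpace.dirac p (x.1 i), by
    obtain ⟨C, hC⟩ := x.2
    exact ⟨C, hC.mono fun i hi => (WassersteinSpace.dist_dirac_dirac_le p _ _).trans hi⟩⟩

/-- The sequence `((1 / N) ∑ⱼ δ_{x_{j,i}})` of Dirac clouds, which is limited in
`(𝒫_p(X_i), W_p, δ_{e_i})`. -/
noncomputable def cloud (p : ℝ) [Fact (1 ≤ p)] {N : ℕ} [NeZero N] (x : Fin N → LimitedSeq ω X e) :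
    LimitedSeq ω (fun i => WassersteinSpace p (X i)) (fun i => WassersteinSpace.dirac p (e i)) :=
  ⟨fun i => WassersteinSpace.cloud p fun j => (x j).1 i, by
    choose C hC using fun j => (x j).2
    refine ⟨∑ j, |C j|, ?_⟩
    filter_upwards [Filter.eventually_all.2 hC] with i hi
    refine WassersteinSpace.dist_cloud_dirac_le p _ _ fun j => (hi j).trans ?_
    exact (le_abs_self _).trans
      (Finset.single_le_sum (f := fun j => |C j|) (fun _ _ => abs_nonneg _) (Finset.mem_univ j))⟩

end LimitedSeq

/-! The map is prescribed on Dirac clouds and extended by density. Three facts carry this.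

Clouds are dense in `𝒫_p` of any metric space (`WassersteinSpace.exists_cloud_dist_lt`): a Radon
measure lives on a σ-compact, hence separable, set, so it can be transported cheaply to finitely
many points, whose weights are then rounded to multiples of `1 / N`.

The distance between two clouds depends only on the matrix of distances between their points. By
`iInf_transportCost_cloud` it is the `p`-th root of the value of a finite transport problem, and
that value is continuous in the costs. Distances between representatives converge along `ω` to
distances in the ultralimit, so the distances between the clouds of representatives converge to the
distance between the clouds in the ultralimit. Hence the prescribed map preserves distances. This
also makes it independent of the representatives, as points at distance zero get equal images.

The target is complete, since a non-principal ultrafilter allows a diagonal choice of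
representatives for a Cauchy sequence. A distance-preserving map on a dense family then has exactly
one isometric extension. -/

/-! ### Extension of isometries from dense families -/

/-- A family into a complete space that respects the distances of a family with dense range
extends to a unique isometry. -/
theorem existsUnique_isometry_of_denseRange {I P Q : Type*} [MetricSpace P] [MetricSpace Q]
    [CompleteSpace Q] {F : I → P} {G : I → Q} (hF : DenseRange F)
    (hFG : ∀ a b, dist (F a) (F b) = dist (G a) (G b)) :
    ∃! ι : P → Q, Isometry ι ∧ ∀ a, ι (F a) = G a := by
  -- With the distance pulled back along `F`, both `F` and `G` are isometries on the index set, so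
  -- `G` never has to be descended to the range of `F`.
  let _ : PseudoMetricSpace I := PseudoMetricSpace.induced F inferInstance
  have hFi : Isometry F := Isometry.of_dist_eq fun _ _ => rfl
  have hGi : Isometry G := Isometry.of_dist_eq fun a b => (hFG a b).symm
  have hd : IsDenseInducing F := hFi.isUniformInducing.isDenseInducing hF
  have hc : Continuous (hd.extend G) :=
    (uniformContinuous_uniformly_extend hFi.isUniformInducing hF hGi.uniformContinuous).continuous
  have he : ∀ a, hd.extend G (F a) = G a := fun a => hd.extend_eq hGi.continuous a
  refine ⟨hd.extend G, ⟨Isometry.of_dist_eq fun x y => ?_, he⟩, fun κ hκ => ?_⟩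
  · refine hF.induction_on₂ (p := fun x y => dist (hd.extend G x) (hd.extend G y) = dist x y)
      (isClosed_eq ?_ continuous_dist) (fun a b => ?_) x y
    · fun_prop
    · rw [he, he, hFG]
  · exact hF.equalizer hκ.1.continuous hc (funext fun a => (hκ.2 a).trans (he a).symm)

/-! ### Completeness of metric ultralimits -/

namespace MetricUltralimit

variable {ω : Ultrafilter ℕ} {X : ℕ → Type u} [∀ i, MetricSpace (X i)] {e : ∀ i, X i}

theorem st_surjective : Function.Surjective (st : LimitedSeq ω X e → MetricUltralimit ω X e) :=
  SeparationQuotient.surjective_mk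

theorem tendsto_dist_st (x y : LimitedSeq ω X e) :
    Tendsto (fun i => dist (x.1 i) (y.1 i)) ω (𝓝 (dist (st x) (st y))) :=
  LimitedSeq.tendsto_dist x y

/-- Metric ultralimits along a non-principal ultrafilter are complete. -/
theorem completeSpace (hω : ∀ n : ℕ, ω ≠ pure n) : CompleteSpace (MetricUltralimit ω X e) := by
  -- Non-principality enters only here: `ω` contains every tail of `ℕ`.
  have hge : ∀ n : ℕ, ∀ᶠ i in (ω : Filter ℕ), n ≤ i := by
    have hcof : (ω : Filter ℕ) ≤ atTop := by
      rw [← Nat.cofinite_eq_atTop]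
      rcases ω.le_cofinite_or_eq_pure with h | ⟨a, ha⟩
      · exact h
      · exact absurd ha (hω a)
    exact fun n => hcof (eventually_ge_atTop n)
  refine Metric.complete_of_convergent_controlled_sequences (fun n => (1 / 2 : ℝ) ^ n)
    (fun n => by positivity) fun u hu => ?_
  choose x hx using fun n => st_surjective (u n)
  let A : ℕ → ℕ → Prop := fun n i => ∀ m ≤ n, dist ((x m).1 i) ((x n).1 i) ≤ (1 / 2 : ℝ) ^ m
  have hA : ∀ n, ∀ᶠ i in (ω : Filter ℕ), A n i := by
    intro n
    refine (eventually_all_finite (Set.finite_Iic n)).2 fun m hm => ?_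
    have h := tendsto_dist_st (x m) (x n)
    rw [hx, hx] at h
    exact (h.eventually_lt_const (hu m m n le_rfl hm)).mono fun i hi => hi.le
  classical
  -- Diagonal index: the last stage up to `i` whose Cauchy bounds hold at coordinate `i`. The
  -- default value `0` is harmless, because `A 0 i` always holds.
  let n : ℕ → ℕ := fun i => Nat.findGreatest (fun n => A n i) i
  have key : ∀ m, ∀ᶠ i in (ω : Filter ℕ), dist ((x m).1 i) ((x (n i)).1 i) ≤ (1 / 2 : ℝ) ^ m := by
    intro m
    filter_upwards [hge m, hA m] with i hi hAi
    exact Nat.findGreatest_spec (P := fun n => A n i) hi hAi m (Nat.le_findGreatest hi hAi)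
  obtain ⟨C, hC⟩ := (x 0).2
  -- The `1` is the bound `(1 / 2) ^ 0` of `key 0`.
  let y : LimitedSeq ω X e := ⟨fun i => (x (n i)).1 i, 1 + C, by
    filter_upwards [key 0, hC] with i h1 h2
    refine (dist_triangle_left _ _ ((x 0).1 i)).trans (add_le_add ?_ h2)
    simpa using h1⟩
  refine ⟨st y, ?_⟩
  have hle : ∀ m, dist (u m) (st y) ≤ (1 / 2 : ℝ) ^ m := by
    intro m
    rw [← hx m]
    exact le_of_tendsto (tendsto_dist_st (x m) y) (key m)
  exact tendsto_iff_dist_tendsto_zero.2 (squeeze_zero (fun _ => dist_nonneg) hle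
    (tendsto_pow_atTop_nhds_zero_of_lt_one (by norm_num) (by norm_num)))

end MetricUltralimit

/-! ### Density of Dirac clouds -/

section Density

variable {X : Type u} [MetricSpace X] [MeasurableSpace X] [BorelSpace X]

theorem wassersteinEDist_le_of_coupling {p : ℝ} (hp : 1 ≤ p) {μ ν : Measure X}
    {γ : Measure (X × X)} (hγ : γ ∈ couplings μ ν) {c : ℝ≥0∞} (hc : transportCost p γ ≤ c) :
    wassersteinEDist p μ ν ≤ c ^ (1 / p) :=
  ENNReal.rpow_le_rpow ((iInf₂_le _ hγ).trans hc) (by positivity)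

/-- A Radon probability measure with finite `p`-th moment is carried to a finitely supported one
by a measurable map with small transport cost. -/
theorem WassersteinSpace.exists_simpleFunc_lintegral_lt {p : ℝ} (hp : 1 ≤ p)
    (μ : WassersteinSpace p X) {ε : ℝ≥0∞} (hε : 0 < ε) :
    ∃ T : SimpleFunc X X, ∫⁻ x, edist x (T x) ^ p ∂μ.toMeasure < ε := by
  have hp0 : 0 < p := by linarith
  obtain ⟨x₀, hx₀⟩ := μ.finite_moment
  obtain ⟨S, -, hS, hS0⟩ := exists_sigmaCompact_full μ.toMeasure
  have := secondCountable_of_isSigmaCompact hS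
  -- Adding `x₀` makes it available as base point of `approxOn`. The approximations then satisfy
  -- `edist x (T n x) ≤ edist x x₀`, so the `p`-th moment dominates.
  have hsep : TopologicalSpace.IsSeparable (insert x₀ S) := by
    rw [Set.insert_eq]
    exact (Set.finite_singleton x₀).isSeparable.union
      (TopologicalSpace.IsSeparable.of_subtype S)
  have := hsep.separableSpace
  have h₀ : x₀ ∈ insert x₀ S := Set.mem_insert _ _
  let T := fun n => SimpleFunc.approxOn (id : X → X) measurable_id (insert x₀ S) x₀ h₀ n
  -- `X` need not be second countable, so `edist` need not be measurable on the product;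
  -- measurability is checked on each of the finitely many fibres of `T n`.
  have hm : ∀ n, Measurable fun x => edist x (T n x) ^ p := fun n =>
    (SimpleFunc.measurable_bind (T n) (fun a x => edist x a)
      fun a => measurable_edist_left).pow_const p
  have hlim : Tendsto (fun n => ∫⁻ x, edist x (T n x) ^ p ∂μ.toMeasure) atTop
      (𝓝 (∫⁻ _, 0 ∂μ.toMeasure)) := by
    refine tendsto_lintegral_of_dominated_convergence (fun x => edist x x₀ ^ p) hm
      (fun n => Eventually.of_forall fun x => ?_) hx₀.ne ?_
    · refine ENNReal.rpow_le_rpow ?_ hp0.le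
      rw [edist_comm, edist_comm x]
      exact SimpleFunc.edist_approxOn_le measurable_id h₀ x n
    · have hae : ∀ᵐ x ∂μ.toMeasure, x ∈ S := hS0
      filter_upwards [hae] with x hx
      have h1 : Tendsto (fun n => T n x) atTop (𝓝 x) :=
        SimpleFunc.tendsto_approxOn measurable_id h₀
          (subset_closure (Set.mem_insert_of_mem _ hx))
      have h2 : Tendsto (fun n => edist x (T n x)) atTop (𝓝 0) := by
        simpa using (tendsto_const_nhds (x := x)).edist h1
      simpa [ENNReal.zero_rpow_of_pos hp0] using h2.ennrpow_const p
  rw [lintegral_zero] at hlim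
  obtain ⟨n, hn⟩ := (hlim.eventually_lt_const hε).exists
  exact ⟨T n, hn⟩

theorem map_simpleFunc_eq_sum_dirac (μ : Measure X) (T : SimpleFunc X X) :
    μ.map T = ∑ a ∈ T.range, μ (T ⁻¹' {a}) • Measure.dirac a := by
  ext s hs
  have h := SimpleFunc.map_lintegral (μ := μ) (s.indicator fun _ => (1 : ℝ≥0∞)) T
  rw [← SimpleFunc.lintegral_eq_lintegral] at h
  have h' : ∫⁻ x, (T.map (s.indicator fun _ => (1 : ℝ≥0∞))) x ∂μ = μ (T ⁻¹' s) := by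
    rw [← lintegral_indicator_one (T.measurable hs)]
    rfl
  rw [Measure.map_apply T.measurable hs, ← h', h, Measure.finsetSum_apply]
  refine Finset.sum_congr rfl fun a _ => ?_
  rw [Measure.smul_apply, Measure.dirac_apply' _ hs, smul_eq_mul, mul_comm]
  rfl

/-- Allows the points of a cloud to be listed by any convenient finite type. The size is a
successor, so that its `NeZero` instance is automatic. -/
theorem WassersteinSpace.exists_cloud_toMeasure_eq (p : ℝ) [Fact (1 ≤ p)] {I : Type*} [Fintype I]
    [Nonempty I] (g : I → X) : ∃ (N : ℕ) (x : Fin (N + 1) → X),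
      (cloud p x).toMeasure = (Fintype.card I : ℝ≥0∞)⁻¹ • ∑ i, Measure.dirac (g i) := by
  obtain ⟨N, hN⟩ := Nat.exists_eq_succ_of_ne_zero (Fintype.card_ne_zero (α := I))
  refine ⟨N, g ∘ (Fintype.equivFinOfCardEq hN).symm, ?_⟩
  simp only [cloud, Function.comp_apply, hN]
  rw [Equiv.sum_comp (Fintype.equivFinOfCardEq hN).symm fun i => Measure.dirac (g i)]

/-- Finitely supported probability measures are approximated by Dirac clouds: round the weights
down to multiples of `1 / N` and move what is left to one point. -/
theorem WassersteinSpace.exists_cloud_wassersteinEDist_sum_dirac_lt (p : ℝ) [hp : Fact (1 ≤ p)]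
    (F : Finset X) (w : X → NNReal) (hw : ∑ a ∈ F, w a = 1) (a₀ : X) {ε : ℝ≥0∞} (hε : 0 < ε) :
    ∃ (N : ℕ) (x : Fin (N + 1) → X),
      wassersteinEDist p (∑ a ∈ F, (w a : ℝ≥0∞) • Measure.dirac a) (cloud p x).toMeasure < ε := by
  have hp0 : 0 < p := by linarith [hp.out]
  let C : ℝ≥0∞ := ∑ a ∈ F, edist a a₀ ^ p
  have hC : C ≠ ∞ := (ENNReal.sum_lt_top.2 fun a _ =>
    ENNReal.rpow_lt_top_of_nonneg hp0.le (edist_ne_top _ _)).ne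
  -- Rounding leaves at most `1 / N` at each atom, and moving that to `a₀` costs at most `C / N` in
  -- total.
  obtain ⟨N, hN0, hN⟩ : ∃ N : ℕ, 0 < N ∧ ((N : ℝ≥0∞)⁻¹ * C) ^ (1 / p) < ε := by
    have h : Tendsto (fun N : ℕ => ((N : ℝ≥0∞)⁻¹ * C) ^ (1 / p)) atTop (𝓝 ((0 * C) ^ (1 / p))) :=
      (ENNReal.Tendsto.mul_const ENNReal.tendsto_inv_nat_nhds_zero (Or.inr hC)).ennrpow_const _
    rw [zero_mul, ENNReal.zero_rpow_of_pos (by positivity)] at h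
    exact ((eventually_gt_atTop 0).and (h.eventually_lt_const hε)).exists
  have hNr : (0 : NNReal) < N := by exact_mod_cast hN0
  let k : X → ℕ := fun a => ⌊N * w a⌋₊
  have hk : ∀ a, (k a : NNReal) ≤ N * w a := fun a => Nat.floor_le zero_le
  have hkN : ∑ a ∈ F, k a ≤ N := by
    have h : ((∑ a ∈ F, k a : ℕ) : NNReal) ≤ N := by
      push_cast
      refine (Finset.sum_le_sum fun a _ => hk a).trans ?_
      rw [← Finset.mul_sum, hw, mul_one]
    exact_mod_cast h
  obtain ⟨r, hr⟩ := Nat.exists_eq_add_of_le hkN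
  let v : X → NNReal := fun a => w a - (N : NNReal)⁻¹ * k a
  have hkw : ∀ a, (N : NNReal)⁻¹ * k a ≤ w a := fun a => by
    rw [inv_mul_le_iff₀ hNr]
    exact hk a
  have hv : ∀ a, (N : NNReal)⁻¹ * k a + v a = w a := fun a => add_tsub_cancel_of_le (hkw a)
  have hvN : ∀ a, v a ≤ (N : NNReal)⁻¹ := fun a => by
    rw [tsub_le_iff_left, ← mul_add_one, ← mul_le_mul_iff_right₀ hNr, mul_inv_cancel_left₀ hNr.ne']
    exact (Nat.lt_floor_add_one _).le
  -- Both the weights and the rounded weights together with `r / N` sum to `1`, so the remainder is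
  -- a whole number of atoms of mass `1 / N`.
  have hvs : ∑ a ∈ F, v a = (N : NNReal)⁻¹ * r := by
    have h1 : (N : NNReal)⁻¹ * ∑ a ∈ F, (k a : NNReal) + ∑ a ∈ F, v a = 1 := by
      rw [Finset.mul_sum, ← Finset.sum_add_distrib, ← hw]
      exact Finset.sum_congr rfl fun a _ => hv a
    have h2 : (N : NNReal)⁻¹ * ∑ a ∈ F, (k a : NNReal) + (N : NNReal)⁻¹ * r = 1 := by
      rw [← mul_add, inv_mul_eq_one₀ hNr.ne']
      exact_mod_cast hr
    exact add_left_cancel (h1.trans h2.symm)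
  let g : (Σ a : F, Fin (k a)) ⊕ Fin r → X := Sum.elim (fun s => s.1) fun _ => a₀
  have hcard : Fintype.card ((Σ a : F, Fin (k a)) ⊕ Fin r) = N := by
    rw [Fintype.card_sum, Fintype.card_sigma, Fintype.card_fin, hr]
    simp only [Fintype.card_fin]
    rw [Finset.sum_coe_sort F k]
  have : Nonempty ((Σ a : F, Fin (k a)) ⊕ Fin r) := Fintype.card_pos_iff.1 (hcard ▸ hN0)
  obtain ⟨M, x, hx⟩ := exists_cloud_toMeasure_eq p g
  have hinv : ((N : NNReal)⁻¹ : NNReal) = ((N : ℝ≥0∞)⁻¹ : ℝ≥0∞) := by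
    rw [ENNReal.coe_inv hNr.ne', ENNReal.coe_natCast]
  have hx' : (cloud p x).toMeasure =
      ∑ a ∈ F, ((N : ℝ≥0∞)⁻¹ * k a) • Measure.dirac a + ((N : ℝ≥0∞)⁻¹ * r) • Measure.dirac a₀ := by
    rw [hx, hcard, Fintype.sum_sum_type, Fintype.sum_sigma]
    simp only [g, Sum.elim_inl, Sum.elim_inr, Finset.sum_const, Finset.card_univ, Fintype.card_fin]
    rw [Finset.sum_coe_sort F fun a => k a • Measure.dirac a, smul_add, Finset.smul_sum]
    simp only [mul_smul, Nat.cast_smul_eq_nsmul]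
  refine ⟨M, x, lt_of_le_of_lt ?_ hN⟩
  -- The rounded mass `k a / N` stays at `a`, and the remainder `v a` goes to `a₀`.
  let γ : Measure (X × X) := ∑ a ∈ F, (((N : ℝ≥0∞)⁻¹ * k a) • Measure.dirac (a, a) +
    (v a : ℝ≥0∞) • Measure.dirac (a, a₀))
  have hmap : ∀ f : X × X → X, Measurable f → γ.map f =
      ∑ a ∈ F, (((N : ℝ≥0∞)⁻¹ * k a) • Measure.dirac (f (a, a)) +
        (v a : ℝ≥0∞) • Measure.dirac (f (a, a₀))) := by
    intro f hf
    ext s hs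
    simp only [γ, Measure.map_apply hf hs, Measure.finsetSum_apply, Measure.add_apply,
      Measure.smul_apply, Measure.dirac_apply' _ hs, Measure.dirac_apply' _ (hf hs)]
    rfl
  refine wassersteinEDist_le_of_coupling hp.out (γ := γ) ⟨?_, ?_⟩ ?_
  · rw [hmap _ measurable_fst]
    refine Finset.sum_congr rfl fun a _ => ?_
    rw [← add_smul, ← hv a, ENNReal.coe_add, ENNReal.coe_mul, hinv, ENNReal.coe_natCast]
  · rw [hmap _ measurable_snd, Finset.sum_add_distrib, hx']
    dsimp only
    rw [← Finset.sum_smul,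
      ← ENNReal.ofNNReal_finsetSum, hvs, ENNReal.coe_mul, hinv, ENNReal.coe_natCast]
  · rw [transportCost, lintegral_finsetSum_measure, Finset.mul_sum]
    refine Finset.sum_le_sum fun a _ => ?_
    rw [lintegral_add_measure, lintegral_smul_measure, lintegral_smul_measure]
    rw [lintegral_dirac, lintegral_dirac, edist_self, ENNReal.zero_rpow_of_pos hp0, smul_zero,
      zero_add, smul_eq_mul, ← hinv]
    gcongr
    exact hvN a

theorem WassersteinSpace.exists_cloud_dist_lt (p : ℝ) [hp : Fact (1 ≤ p)]
    (μ : WassersteinSpace p X) {ε : ℝ} (hε : 0 < ε) :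
    ∃ (N : ℕ) (x : Fin (N + 1) → X), dist μ (cloud p x) < ε := by
  have hp0 : 0 < p := by linarith [hp.out]
  have hε2 : 0 < ENNReal.ofReal (ε / 2) := by simpa using hε
  obtain ⟨T, hT⟩ := μ.exists_simpleFunc_lintegral_lt hp.out (ε := ENNReal.ofReal (ε / 2) ^ p)
    (ENNReal.rpow_pos hε2 ENNReal.ofReal_ne_top)
  obtain ⟨x₀, -⟩ := μ.finite_moment
  have hprob : IsProbabilityMeasure (μ.toMeasure.map T) :=
    Measure.isProbabilityMeasure_map T.measurable.aemeasurable
  let w : X → NNReal := fun a => (μ.toMeasure (T ⁻¹' {a})).toNNReal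
  have hwc : ∀ a, (w a : ℝ≥0∞) = μ.toMeasure (T ⁻¹' {a}) := fun a =>
    ENNReal.coe_toNNReal (measure_ne_top _ _)
  have hsum : μ.toMeasure.map T = ∑ a ∈ T.range, (w a : ℝ≥0∞) • Measure.dirac a := by
    simp only [hwc]
    exact map_simpleFunc_eq_sum_dirac _ T
  have hw : ∑ a ∈ T.range, w a = 1 := by
    have h : (μ.toMeasure.map T) Set.univ = 1 := measure_univ
    rw [hsum] at h
    simp only [Measure.finsetSum_apply, Measure.smul_apply, measure_univ, smul_eq_mul,
      mul_one] at h
    exact_mod_cast h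
  obtain ⟨N, x, hx⟩ := exists_cloud_wassersteinEDist_sum_dirac_lt p T.range w hw x₀ hε2
  rw [← hsum] at hx
  -- The triangle inequality rests on gluing, which needs Radon measures; the intermediate measure
  -- is a finite combination of Dirac masses.
  have hreg : (μ.toMeasure.map T).InnerRegular := by
    rw [hsum]
    infer_instance
  have h1 : wassersteinEDist p μ.toMeasure (μ.toMeasure.map T) ≤ ENNReal.ofReal (ε / 2) := by
    have hm : Measurable fun x => (x, T x) := measurable_id.prodMk T.measurable
    have h := wassersteinEDist_le_of_coupling (μ := μ.toMeasure) (ν := μ.toMeasure.map T) hp.out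
      (γ := μ.toMeasure.map fun x => (x, T x))
      ⟨by rw [Measure.map_map measurable_fst hm]; exact Measure.map_id,
        by rw [Measure.map_map measurable_snd hm]; rfl⟩ ((lintegral_map_le _ _).trans hT.le)
    rwa [← ENNReal.rpow_mul, mul_one_div_cancel hp0.ne', ENNReal.rpow_one] at h
  refine ⟨N, x, ENNReal.toReal_lt_of_lt_ofReal ?_⟩
  calc wassersteinEDist p μ.toMeasure (cloud p x).toMeasure
      ≤ wassersteinEDist p μ.toMeasure (μ.toMeasure.map T) +
        wassersteinEDist p (μ.toMeasure.map T) (cloud p x).toMeasure :=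
        wassersteinEDist_triangle p hp.out _ _ _
    _ < ENNReal.ofReal (ε / 2) + ENNReal.ofReal (ε / 2) :=
        ENNReal.add_lt_add_of_le_of_lt (h1.trans_lt ENNReal.ofReal_lt_top).ne h1 hx
    _ = ENNReal.ofReal ε := by
        rw [← ENNReal.ofReal_add (by positivity) (by positivity), add_halves]

end Density

/-! ### Transport between clouds as a finite problem -/

section Clouds

variable {X : Type u} [MetricSpace X] [MeasurableSpace X] [BorelSpace X]

/-- The transport plans between `N` points of mass `1 / N` and `M` points of mass `1 / M`. -/
def uniformPlans (N M : ℕ) : Set (Fin N → Fin M → ℝ≥0∞) :=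
  {a | (∀ j, ∑ k, a j k = (N : ℝ≥0∞)⁻¹) ∧ ∀ k, ∑ j, a j k = (M : ℝ≥0∞)⁻¹}

/-- A measurable partition of unity on the range of a finite family, which splits every value
evenly among the indices where it is attained. -/
theorem exists_even_splitting {N : ℕ} (x : Fin N → X) :
    ∃ f : Fin N → X → ℝ≥0∞, (∀ j, Measurable (f j)) ∧ (∀ j, ∑ l, f j (x l) = 1) ∧
      (∀ l, ∑ j, f j (x l) = 1) ∧ ∀ j z, f j z ≠ 0 → z = x j := by
  classical
  -- The multiplicity of `z` in the family; each index attaining `z` receives the share `1 / m z`.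
  let m : X → ℕ := fun z => (Finset.univ.filter fun l => x l = z).card
  have hm : ∀ j, (m (x j) : ℝ≥0∞) ≠ 0 := fun j => by
    simp only [m, ne_eq, Nat.cast_eq_zero, Finset.card_eq_zero]
    exact Finset.ne_empty_of_mem (a := j) (by simp)
  have hs : ∀ (z : X) (c : ℝ≥0∞), ∑ l, (if x l = z then c else 0) = m z * c := fun z c => by
    rw [← Finset.sum_filter, Finset.sum_const, nsmul_eq_mul]
  refine ⟨fun j => ({x j} : Set X).indicator fun _ => (m (x j) : ℝ≥0∞)⁻¹,
    fun j => measurable_const.indicator (measurableSet_singleton _), fun j => ?_, fun l => ?_,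
    fun j z hz => ?_⟩
  · simp only [Set.indicator_apply, Set.mem_singleton_iff]
    rw [hs, ENNReal.mul_inv_cancel (hm j) (ENNReal.natCast_ne_top _)]
  · rw [← ENNReal.mul_inv_cancel (hm l) (ENNReal.natCast_ne_top _), ← hs]
    refine Finset.sum_congr rfl fun j _ => ?_
    simp only [Set.indicator_apply, Set.mem_singleton_iff]
    by_cases h : x l = x j
    · simp [h]
    · simp [h, Ne.symm h]
  · exact Set.mem_singleton_iff.1 (Set.mem_of_indicator_ne_zero hz)

theorem WassersteinSpace.lintegral_cloud (p : ℝ) [Fact (1 ≤ p)] {N : ℕ} [NeZero N] (x : Fin N → X)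
    (f : X → ℝ≥0∞) : ∫⁻ z, f z ∂(cloud p x).toMeasure = (N : ℝ≥0∞)⁻¹ * ∑ j, f (x j) := by
  simp only [cloud, lintegral_smul_measure, lintegral_finsetSum_measure, lintegral_dirac,
    smul_eq_mul]

theorem WassersteinSpace.ae_cloud_mem_range (p : ℝ) [Fact (1 ≤ p)] {N : ℕ} [NeZero N]
    (x : Fin N → X) : ∀ᵐ z ∂(cloud p x).toMeasure, z ∈ Set.range x := by
  have hm : MeasurableSet (Set.range x)ᶜ := (Set.finite_range x).measurableSet.compl
  rw [ae_iff]
  change (cloud p x).toMeasure (Set.range x)ᶜ = 0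
  rw [← lintegral_indicator_one hm, lintegral_cloud]
  simp

/-- The optimal transport cost between Dirac clouds is a minimum over matrices. -/
theorem iInf_transportCost_cloud (p : ℝ) [hp : Fact (1 ≤ p)] {N M : ℕ} [NeZero N] [NeZero M]
    (x : Fin N → X) (y : Fin M → X) :
    (⨅ γ ∈ couplings (WassersteinSpace.cloud p x).toMeasure
      (WassersteinSpace.cloud p y).toMeasure, transportCost p γ) =
      ⨅ a ∈ uniformPlans N M, ∑ j, ∑ k, a j k * edist (x j) (y k) ^ p := by
  refine le_antisymm (le_iInf₂ fun a ha => ?_) (le_iInf₂ fun γ hγ => ?_)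
  · let γ : Measure (X × X) := ∑ j, ∑ k, a j k • Measure.dirac (x j, y k)
    have hmap : ∀ f : X × X → X, Measurable f →
        γ.map f = ∑ j, ∑ k, a j k • Measure.dirac (f (x j, y k)) := by
      intro f hf
      ext s hs
      simp only [γ, Measure.map_apply hf hs, Measure.finsetSum_apply,
        Measure.smul_apply, Measure.dirac_apply' _ hs, Measure.dirac_apply' _ (hf hs)]
      rfl
    have hγ : γ ∈ couplings (WassersteinSpace.cloud p x).toMeasure
        (WassersteinSpace.cloud p y).toMeasure := by
      constructor
      · rw [hmap _ measurable_fst]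
        simp only [← Finset.sum_smul, ha.1, WassersteinSpace.cloud, Finset.smul_sum]
      · rw [hmap _ measurable_snd, Finset.sum_comm]
        simp only [← Finset.sum_smul, ha.2, WassersteinSpace.cloud, Finset.smul_sum]
    refine (iInf₂_le γ hγ).trans (le_of_eq ?_)
    simp only [transportCost, γ, lintegral_finsetSum_measure, lintegral_smul_measure,
        lintegral_dirac, smul_eq_mul]
  -- The points may repeat, so `γ` alone does not determine a matrix. Its mass at each pair of
  -- values is divided evenly among the pairs of indices attaining it, which keeps the marginals
  -- uniform and the cost unchanged.
  · obtain ⟨f, hfm, hf1, hf2, hf3⟩ := exists_even_splitting x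
    obtain ⟨g, hgm, hg1, hg2, hg3⟩ := exists_even_splitting y
    have hfm' : ∀ j, Measurable fun z : X × X => f j z.1 := fun j => (hfm j).comp measurable_fst
    have hgm' : ∀ k, Measurable fun z : X × X => g k z.2 := fun k => (hgm k).comp measurable_snd
    have hx : ∀ᵐ z ∂γ, ∑ j, f j z.1 = 1 := by
      have h := WassersteinSpace.ae_cloud_mem_range p x
      rw [← hγ.1] at h
      filter_upwards [ae_of_ae_map measurable_fst.aemeasurable h] with z ⟨l, hl⟩
      rw [← hl, hf2]
    have hy : ∀ᵐ z ∂γ, ∑ k, g k z.2 = 1 := by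
      have h := WassersteinSpace.ae_cloud_mem_range p y
      rw [← hγ.2] at h
      filter_upwards [ae_of_ae_map measurable_snd.aemeasurable h] with z ⟨l, hl⟩
      rw [← hl, hg2]
    have hfi : ∀ j, ∫⁻ z, f j z.1 ∂γ = (N : ℝ≥0∞)⁻¹ := fun j => by
      rw [← lintegral_map (hfm j) measurable_fst, hγ.1, WassersteinSpace.lintegral_cloud, hf1,
        mul_one]
    have hgi : ∀ k, ∫⁻ z, g k z.2 ∂γ = (M : ℝ≥0∞)⁻¹ := fun k => by
      rw [← lintegral_map (hgm k) measurable_snd, hγ.2, WassersteinSpace.lintegral_cloud, hg1,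
        mul_one]
    have hfg : ∀ j k, Measurable fun z : X × X => f j z.1 * g k z.2 := fun j k =>
      (hfm' j).mul (hgm' k)
    have ha : (fun j k => ∫⁻ z, f j z.1 * g k z.2 ∂γ) ∈ uniformPlans N M := by
      refine ⟨fun j => ?_, fun k => ?_⟩
      · rw [← lintegral_finsetSum _ fun k _ => hfg j k, ← hfi j]
        refine lintegral_congr_ae (hy.mono fun z hz => ?_)
        simp only [← Finset.mul_sum, hz, mul_one]
      · rw [← lintegral_finsetSum _ fun j _ => hfg j k, ← hgi k]
        refine lintegral_congr_ae (hx.mono fun z hz => ?_)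
        simp only [← Finset.sum_mul, hz, one_mul]
    refine (iInf₂_le _ ha).trans (le_of_eq ?_)
    have hterm : ∀ j k, (∫⁻ z, f j z.1 * g k z.2 ∂γ) * edist (x j) (y k) ^ p =
        ∫⁻ z, f j z.1 * g k z.2 * edist z.1 z.2 ^ p ∂γ := by
      intro j k
      rw [← lintegral_mul_const _ (hfg j k)]
      refine lintegral_congr fun z => ?_
      by_cases h1 : f j z.1 = 0
      · simp [h1]
      by_cases h2 : g k z.2 = 0
      · simp [h2]
      rw [hf3 j _ h1, hg3 k _ h2]
    have hd := (aemeasurable_edist_of_coupling hγ).pow_const p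
    have hm : ∀ j k, AEMeasurable (fun z : X × X => f j z.1 * g k z.2 * edist z.1 z.2 ^ p) γ :=
      fun j k => (hfg j k).aemeasurable.mul hd
    simp only [hterm, ← lintegral_finsetSum' _ fun k _ => hm _ k]
    rw [← lintegral_finsetSum' _ fun j _ => Finset.aemeasurable_fun_sum _ fun k _ => hm j k]
    refine lintegral_congr_ae ?_
    filter_upwards [hx, hy] with z hzx hzy
    simp only [← Finset.sum_mul, ← Finset.mul_sum, hzx, hzy, one_mul, mul_one]

/-- Every plan has total mass `N · (1 / N) = 1`, so raising all costs by `ε` raises its total cost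
by exactly `ε`. -/
theorem iInf_uniformPlans_le_add {N M : ℕ} [NeZero N] {c c' : Fin N → Fin M → ℝ≥0∞}
    {ε : ℝ≥0∞} (h : ∀ j k, c j k ≤ c' j k + ε) :
    (⨅ a ∈ uniformPlans N M, ∑ j, ∑ k, a j k * c j k) ≤
      (⨅ a ∈ uniformPlans N M, ∑ j, ∑ k, a j k * c' j k) + ε := by
  simp only [ENNReal.iInf_add]
  refine iInf₂_mono fun a ha => ?_
  have hε : ∑ j, ∑ k, a j k * ε = ε := by
    simp only [← Finset.sum_mul, ha.1]
    rw [Finset.sum_const, Finset.card_univ, Fintype.card_fin, nsmul_eq_mul,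
      ENNReal.mul_inv_cancel (Nat.cast_ne_zero.2 (NeZero.ne N)) (ENNReal.natCast_ne_top N), one_mul]
  calc ∑ j, ∑ k, a j k * c j k ≤ ∑ j, ∑ k, (a j k * c' j k + a j k * ε) := by
        gcongr with j _ k _
        rw [← mul_add]
        gcongr
        exact h j k
    _ = ∑ j, ∑ k, a j k * c' j k + ε := by
        simp only [Finset.sum_add_distrib, hε]

/-- The optimal cost over matrices depends continuously on the cost function. -/
theorem tendsto_iInf_uniformPlans {N M : ℕ} [NeZero N] {I : Type*} {l : Filter I}
    {c : I → Fin N → Fin M → ℝ≥0∞} {c₀ : Fin N → Fin M → ℝ≥0∞} (hc₀ : ∀ j k, c₀ j k ≠ ∞)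
    (h : ∀ j k, Tendsto (fun i => c i j k) l (𝓝 (c₀ j k)))
    (hfin : (⨅ a ∈ uniformPlans N M, ∑ j, ∑ k, a j k * c₀ j k) ≠ ∞) :
    Tendsto (fun i => ⨅ a ∈ uniformPlans N M, ∑ j, ∑ k, a j k * c i j k) l
      (𝓝 (⨅ a ∈ uniformPlans N M, ∑ j, ∑ k, a j k * c₀ j k)) := by
  refine (ENNReal.tendsto_nhds hfin).2 fun ε hε => ?_
  -- There are finitely many index pairs, so all costs are eventually within `ε` at once; the
  -- preceding comparison then applies in both directions.
  have hev : ∀ᶠ i in l, ∀ j k, c i j k ∈ Set.Icc (c₀ j k - ε) (c₀ j k + ε) :=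
    eventually_all.2 fun j => eventually_all.2 fun k =>
      (ENNReal.tendsto_nhds (hc₀ j k)).1 (h j k) ε hε
  filter_upwards [hev] with i hi
  exact ⟨tsub_le_iff_right.2 (iInf_uniformPlans_le_add fun j k => tsub_le_iff_right.1 (hi j k).1),
    iInf_uniformPlans_le_add fun j k => (hi j k).2⟩

/-- The Wasserstein distance of Dirac clouds depends continuously on the distances of their
points. -/
theorem WassersteinSpace.tendsto_dist_cloud (p : ℝ) [hp : Fact (1 ≤ p)] {N M : ℕ} [NeZero N]
    [NeZero M] {I : Type*} {l : Filter I} {Y : I → Type*} [∀ i, MetricSpace (Y i)]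
    [∀ i, MeasurableSpace (Y i)] [∀ i, BorelSpace (Y i)] {x : ∀ i, Fin N → Y i}
    {y : ∀ i, Fin M → Y i} {x₀ : Fin N → X} {y₀ : Fin M → X}
    (h : ∀ j k, Tendsto (fun i => dist (x i j) (y i k)) l (𝓝 (dist (x₀ j) (y₀ k)))) :
    Tendsto (fun i => dist (cloud p (x i)) (cloud p (y i))) l
      (𝓝 (dist (cloud p x₀) (cloud p y₀))) := by
  have hp0 : 0 < p := by linarith [hp.out]
  have htop := wassersteinEDist_ne_top p hp.out (cloud p x₀) (cloud p y₀)
  refine (ENNReal.tendsto_toReal htop).comp ?_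
  simp only [wassersteinEDist] at htop ⊢
  -- Afterwards all infima run over the same set of matrices, although the spaces `Y i` vary with
  -- `i`.
  simp only [iInf_transportCost_cloud] at htop ⊢
  refine Tendsto.ennrpow_const _ (tendsto_iInf_uniformPlans
    (fun j k => ENNReal.rpow_ne_top_of_nonneg hp0.le (edist_ne_top _ _)) (fun j k => ?_) ?_)
  · simp only [edist_dist]
    exact (ENNReal.tendsto_ofReal (h j k)).ennrpow_const p
  · intro h
    rw [h, ENNReal.top_rpow_of_pos (by positivity)] at htop
    exact htop rfl

end Clouds

/-! ### Construction and uniqueness of the embedding -/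

theorem mainTheorem2 (p : ℝ) [Fact (1 ≤ p)]
    (ω : Ultrafilter ℕ) (hω : ∀ n : ℕ, ω ≠ pure n)
    (X : ℕ → Type u) [∀ i, MetricSpace (X i)] [∀ i, CompleteSpace (X i)]
    [∀ i, MeasurableSpace (X i)] [∀ i, BorelSpace (X i)] (e : ∀ i, X i) :
    ∃! ι : WassersteinSpace p (MetricUltralimit ω X e) →
        MetricUltralimit ω (fun i => WassersteinSpace p (X i))
          (fun i => WassersteinSpace.dirac p (e i)),
      Isometry ι ∧
      (∀ x : LimitedSeq ω X e,
        ι (WassersteinSpace.dirac p (MetricUltralimit.st x)) =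
          MetricUltralimit.st (LimitedSeq.dirac p x)) ∧
      (∀ (N : ℕ) [NeZero N] (x : Fin N → LimitedSeq ω X e),
        ι (WassersteinSpace.cloud p fun j => MetricUltralimit.st (x j)) =
          MetricUltralimit.st (LimitedSeq.cloud p x)) := by
  have := MetricUltralimit.completeSpace (X := fun i => WassersteinSpace p (X i))
    (e := fun i => WassersteinSpace.dirac p (e i)) hω
  have hdense : DenseRange fun s : Σ N : ℕ, Fin (N + 1) → LimitedSeq ω X e =>
      WassersteinSpace.cloud p fun j => MetricUltralimit.st (s.2 j) := by
    refine Metric.denseRange_iff.2 fun μ ε hε => ?_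
    obtain ⟨N, x, hx⟩ := μ.exists_cloud_dist_lt p hε
    choose y hy using fun j => MetricUltralimit.st_surjective (x j)
    refine ⟨⟨N, y⟩, ?_⟩
    simpa only [hy] using hx
  -- Both sides are limits along `ω` of the same sequence, the distances between the clouds of
  -- representatives.
  have hdist : ∀ s t : Σ N : ℕ, Fin (N + 1) → LimitedSeq ω X e,
      dist (WassersteinSpace.cloud p fun j => MetricUltralimit.st (s.2 j))
        (WassersteinSpace.cloud p fun j => MetricUltralimit.st (t.2 j)) =
      dist (MetricUltralimit.st (LimitedSeq.cloud p s.2))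
        (MetricUltralimit.st (LimitedSeq.cloud p t.2)) := fun s t =>
    tendsto_nhds_unique (WassersteinSpace.tendsto_dist_cloud p fun j k =>
      MetricUltralimit.tendsto_dist_st (s.2 j) (t.2 k)) (MetricUltralimit.tendsto_dist_st _ _)
  obtain ⟨ι, ⟨hι, hcloud⟩, huniq⟩ := existsUnique_isometry_of_denseRange hdense hdist
  -- A Dirac mass is a one-point cloud, so the condition on Dirac masses follows from the one on
  -- clouds. The form `0 + 1` matches the index family.
  have hdirac : ∀ {Y : Type u} [MetricSpace Y] [MeasurableSpace Y] [BorelSpace Y] (a : Y),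
      WassersteinSpace.dirac p a = WassersteinSpace.cloud p fun _ : Fin (0 + 1) => a := by
    intro Y _ _ _ a
    apply WassersteinSpace.ext
    simp [WassersteinSpace.dirac, WassersteinSpace.cloud]
  refine ⟨ι, ⟨hι, fun x => ?_, fun N hN x => ?_⟩, fun κ hκ => huniq κ ⟨hκ.1, fun s => hκ.2.2 _ _⟩⟩
  · rw [hdirac]
    have h : LimitedSeq.dirac p x = LimitedSeq.cloud p fun _ : Fin (0 + 1) => x :=
      Subtype.ext (funext fun i => hdirac (x.1 i))
    rw [h]
    exact hcloud ⟨0, fun _ => x⟩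
  · obtain ⟨n, rfl⟩ := Nat.exists_eq_succ_of_ne_zero hN.out
    exact hcloud ⟨n, x⟩
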